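/- Let $N$ be the number of stages, let $\Xi=\Xi_1\times\cdots\times\Xi_N$ be a finite set of scenarios $\xi=(\xi_1,\dots,\xi_N)$, and let $p(\xi)>0$ for $\xi\in\Xi$, with $\sum_{\xi\in\Xi}p(\xi)=1$. Let $n=n_1+\cdots+n_N$ and let $\mathcal L_n$ be the Hilbert space of all mappings $x(\cdot):\Xi\to\mathbb R^n$, $x(\xi)=(x_1(\xi),\dots,x_N(\xi))$ with $x_k(\xi)\in\mathbb R^{n_k}$, with inner product $$\langle x(\cdot),w(\cdot)\rangle=\sum_{\xi\in\Xi}p(\xi)\sum_{k=1}^N\langle x_k(\xi),w_k(\xi)\rangle .$$ Let $\mathcal N_n\subset\mathcal L_n$ be the subspace of those $x(\cdot)$ for which, for every $k$, $x_k(\xi)$ does not depend on $\xi_k,\dots,\xi_N$. For each $\xi\in\Xi$ let $C(\xi)\subset\mathbb R^n$ be nonempty, closed and convex, and let $\mathcal C=\{x(\cdot)\in\mathcal L_n: x(\xi)\in C(\xi)\ \forall\xi\in\Xi\}$. Given $F(\cdot,\xi):\mathbb R^n\to\mathbb R^n$ for $\xi\in\Xi$, define $\mathcal F:\mathcal L_n\to\mathcal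 L_n$ by $\mathcal F(x(\cdot))(\xi)=F(x(\xi),\xi)$. Write $\mathrm{SOL}(\mathcal C\cap\mathcal N_n,\mathcal F)$ for the set of solutions of the stochastic variational inequality (SVI), that is, of those $x(\cdot)\in\mathcal C\cap\mathcal N_n$ such that $-\mathcal F(x(\cdot))\in N_{\mathcal C\cap\mathcal N_n}(x(\cdot))$, where $N_{\mathcal C\cap\mathcal N_n}(x(\cdot))=\{v(\cdot)\in\mathcal L_n:\langle v(\cdot),y(\cdot)-x(\cdot)\rangle\le 0\ \ \forall y(\cdot)\in\mathcal C\cap\mathcal N_n\}$ is the normal cone at $x(\cdot)\in\mathcal C\cap\mathcal N_n$. Assume that $\mathcal F:\mathcal L_n\to\mathcal L_n$ is continuous and that it is pseudomonotone on $\mathcal C\cap\mathcal N_n$, that is, for all $x(\cdot),y(\cdot)\in\mathcal C\cap\mathcal N_n$, $$\langle y(\cdot)-x(\cdot),\mathcal F(x(\cdot))\rangle\ge0\ \Longrightarrow\ \langle y(\cdot)-x(\cdot),\mathcal F(y(\cdot))\rangle\ge0 .$$ Then the following three statements are equivalent: (a) There exists $\hat x(\cdot)\in\mathcal C\cap\mathcal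 N_n$ such that the set $L_<=\{x(\cdot)\in\mathcal C\cap\mathcal N_n:\langle\mathcal F(x(\cdot)),x(\cdot)-\hat x(\cdot)\rangle<0\}$ is bounded (possibly empty). (b) There exist a bounded open set $\Omega\subset\mathcal L_n$ and some $\hat x(\cdot)\in\mathcal C\cap\mathcal N_n\cap\Omega$ such that $\langle\mathcal F(x(\cdot)),x(\cdot)-\hat x(\cdot)\rangle\ge0$ for all $x(\cdot)\in\mathcal C\cap\mathcal N_n\cap\mathrm{bd}\,\Omega$, where $\mathrm{bd}\,\Omega$ is the boundary of $\Omega$ in $\mathcal L_n$. (c) The SVI has a solution, i.e. $\mathrm{SOL}(\mathcal C\cap\mathcal N_n,\mathcal F)\neq\emptyset$. Moreover, if there exists $\hat x(\cdot)\in\mathcal C\cap\mathcal N_n$ such that the set $L_\le=\{x(\cdot)\in\mathcal C\cap\mathcal N_n:\langle\mathcal F(x(\cdot)),x(\cdot)-\hat x(\cdot)\rangle\le0\}$ is bounded, then $\mathrm{SOL}(\mathcal C\cap\mathcal N_n,\mathcal F)$ is nonempty and compact. -/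

import Mathlib

open scoped InnerProductSpace

noncomputable section

namespace StochasticVI

/-- Scenarios `ξ = (ξ₁, …, ξ_N)` of an `N`-stage problem: the product `Ξ₁ × ⋯ × Ξ_N`. -/
abbrev Scenario {N : ℕ} (Ξ : Fin N → Type*) := (k : Fin N) → Ξ k

/-- A strictly positive probability on the finite set of scenarios. -/
structure ScenarioProb {N : ℕ} (Ξ : Fin N → Type*) [∀ k, Fintype (Ξ k)] where
  prob : Scenario Ξ → ℝ
  prob_pos : ∀ ξ, 0 < prob ξ
  sum_prob : ∑ ξ, prob ξ = 1

/-- The Euclidean space `ℝⁿ = ℝ^{n₁} × ⋯ × ℝ^{n_N}`, where `n = n₁ + ⋯ + n_N`. -/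
abbrev StageVec {N : ℕ} (n : Fin N → ℕ) :=
  PiLp 2 (fun k : Fin N => EuclideanSpace ℝ (Fin (n k)))

/-- The space `𝓛ₙ` of all mappings `x(·)` from the scenarios to `ℝⁿ`. It is a type of its own,
so that it carries only the probability-weighted Hilbert structure given below. -/
def Lspace {N : ℕ} (n : Fin N → ℕ) {Ξ : Fin N → Type*} [∀ k, Fintype (Ξ k)]
    (_P : ScenarioProb Ξ) :=
  Scenario Ξ → StageVec n

variable {N : ℕ} {n : Fin N → ℕ} {Ξ : Fin N → Type*} [∀ k, Fintype (Ξ k)] {P : ScenarioProb Ξ}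

instance : AddCommGroup (Lspace n P) := inferInstanceAs (AddCommGroup (Scenario Ξ → StageVec n))

instance : Module ℝ (Lspace n P) := inferInstanceAs (Module ℝ (Scenario Ξ → StageVec n))

/-- The inner product `⟨x(·), w(·)⟩ = ∑_ξ p(ξ) ∑_k ⟨x_k(ξ), w_k(ξ)⟩`. -/
@[reducible]
def innerCore : InnerProductSpace.Core ℝ (Lspace n P) where
  inner x w := ∑ ξ, P.prob ξ * ∑ k, ⟪x ξ k, w ξ k⟫_ℝ
  conj_inner_symm x w := by
    simp [real_inner_comm]
  re_inner_nonneg x := by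
    refine Finset.sum_nonneg fun ξ _ => mul_nonneg (P.prob_pos ξ).le ?_
    exact Finset.sum_nonneg fun k _ => real_inner_self_nonneg
  add_left x y z := by
    have h : ∀ ξ k, (x + y : Lspace n P) ξ k = x ξ k + y ξ k := fun _ _ => rfl
    simp only [h, inner_add_left, Finset.sum_add_distrib, mul_add]
  smul_left x y r := by
    have h : ∀ ξ k, (r • x : Lspace n P) ξ k = r • x ξ k := fun _ _ => rfl
    simp only [h, real_inner_smul_left, ← Finset.mul_sum, mul_left_comm _ r]
    rfl
  definite x hx := by
    have h0 : ∀ ξ, 0 ≤ ∑ k, ⟪x ξ k, x ξ k⟫_ℝ := fun ξ =>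
      Finset.sum_nonneg fun k _ => real_inner_self_nonneg
    have h1 := (Finset.sum_eq_zero_iff_of_nonneg
      (fun ξ _ => mul_nonneg (P.prob_pos ξ).le (h0 ξ))).1 hx
    funext ξ
    have h2 := (mul_eq_zero.1 (h1 ξ (Finset.mem_univ ξ))).resolve_left (P.prob_pos ξ).ne'
    have h3 := (Finset.sum_eq_zero_iff_of_nonneg (fun k _ => real_inner_self_nonneg)).1 h2
    ext1 k
    exact inner_self_eq_zero.1 (h3 k (Finset.mem_univ k))

instance : NormedAddCommGroup (Lspace n P) := innerCore.toNormedAddCommGroup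

instance : InnerProductSpace ℝ (Lspace n P) := InnerProductSpace.ofCore innerCore.toCore

theorem inner_def (x w : Lspace n P) :
    ⟪x, w⟫_ℝ = ∑ ξ, P.prob ξ * ∑ k, ⟪x ξ k, w ξ k⟫_ℝ := rfl

/-- The nonanticipativity subspace `𝓝ₙ`: `x_k(ξ)` does not depend on `ξ_k, …, ξ_N`. -/
def nonanticipative (n : Fin N → ℕ) (P : ScenarioProb Ξ) : Submodule ℝ (Lspace n P) where
  carrier := {x | ∀ (k : Fin N) (ξ η : Scenario Ξ), (∀ j < k, ξ j = η j) → x ξ k = x η k}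
  zero_mem' := fun _ _ _ _ => rfl
  add_mem' := fun hx hy k ξ η h => congrArg₂ (· + ·) (hx k ξ η h) (hy k ξ η h)
  smul_mem' := fun r _ hx k ξ η h => congrArg (r • ·) (hx k ξ η h)

/-- The constraint set `𝓒 = {x(·) : x(ξ) ∈ C(ξ) for all ξ}`. -/
def constraintSet (P : ScenarioProb Ξ) (C : Scenario Ξ → Set (StageVec n)) :
    Set (Lspace n P) :=
  {x | ∀ ξ, x ξ ∈ C ξ}

/-- The feasible set `𝓒 ∩ 𝓝ₙ`. -/
def feasibleSet (P : ScenarioProb Ξ) (C : Scenario Ξ → Set (StageVec n)) :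
    Set (Lspace n P) :=
  constraintSet P C ∩ (nonanticipative n P : Set (Lspace n P))

/-- The mapping `𝓕 : 𝓛ₙ → 𝓛ₙ`, `𝓕(x(·)) : ξ ↦ F(x(ξ), ξ)`. -/
def superposition (P : ScenarioProb Ξ) (F : StageVec n → Scenario Ξ → StageVec n) :
    Lspace n P → Lspace n P :=
  fun x ξ => F (x ξ) ξ

section VI

variable {E : Type*} [NormedAddCommGroup E] [InnerProductSpace ℝ E]

/-- Pseudomonotonicity of `G` on `K`. -/
def PseudomonotoneOn (G : E → E) (K : Set E) : Prop :=
  ∀ x ∈ K, ∀ y ∈ K, 0 ≤ ⟪y - x, G x⟫_ℝ → 0 ≤ ⟪y - x, G y⟫_ℝ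

/-- The normal cone of `K` at `x`, with the usual convention that it is empty for `x ∉ K`. -/
def normalCone (K : Set E) (x : E) : Set E :=
  {v | x ∈ K ∧ ∀ y ∈ K, ⟪v, y - x⟫_ℝ ≤ 0}

/-- The solution set of the variational inequality `-G x ∈ N_K(x)`. -/
def solutionSet (K : Set E) (G : E → E) : Set E :=
  {x | -G x ∈ normalCone K x}

/-- `L_< = {x ∈ K : ⟨G x, x - x̂⟩ < 0}`. -/
def strictSublevel (K : Set E) (G : E → E) (xhat : E) : Set E :=
  {x | x ∈ K ∧ ⟪G x, x - xhat⟫_ℝ < 0}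

/-- `L_≤ = {x ∈ K : ⟨G x, x - x̂⟩ ≤ 0}`. -/
def weakSublevel (K : Set E) (G : E → E) (xhat : E) : Set E :=
  {x | x ∈ K ∧ ⟪G x, x - xhat⟫_ℝ ≤ 0}

end VI

end StochasticVI

end

namespace StochasticVI

/-! ### Intersections of closed convex sets -/

section Intersection

variable {E ι : Type*} [NormedAddCommGroup E] [NormedSpace ℝ E]

/-! The feasible set is closed and convex in a finite-dimensional space, so everything reduces to a
variational inequality on such a `K`. On a compact `K`, pseudomonotonicity makes the Minty
half-spaces satisfy the KKM covering condition. As they are convex, a Klee-type intersection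
theorem, proved by separation, replaces Brouwer's theorem. Compactness then gives a Minty solution,
which is a solution by continuity. For unbounded `K`, (b) implies (c) by solving on a large ball
around `Ω`; the frontier inequality shows that the truncation costs nothing. (a) gives (b) with a
ball as `Ω`, and (c) gives (a) because a solution taken as `xhat` makes `L_<` empty. -/

theorem exists_mem_eq_of_convex {S : Set E} (hS : Convex ℝ S) (f : StrongDual ℝ E) {a b : E}
    (ha : a ∈ S) (hb : b ∈ S) {u : ℝ} (hau : f a ≤ u) (hub : u ≤ f b) : ∃ c ∈ S, f c = u :=
  hS.isPreconnected.intermediate_value ha hb f.continuous.continuousOn ⟨hau, hub⟩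

/-- Klee's intersection theorem: if a nonempty compact convex set `S` is covered by finitely many
closed convex sets, and all but any one of them have a common point in `S`, then all of them do. -/
theorem exists_mem_forall_mem_of_convex_cover [DecidableEq ι] (t : Finset ι) (A : ι → Set E)
    (hA_closed : ∀ i, IsClosed (A i)) (hA_convex : ∀ i, Convex ℝ (A i)) :
    ∀ S : Set E, IsCompact S → Convex ℝ S → S.Nonempty → (∀ x ∈ S, ∃ i ∈ t, x ∈ A i) →
      (∀ j ∈ t, ∃ x ∈ S, ∀ i ∈ t.erase j, x ∈ A i) → ∃ x ∈ S, ∀ i ∈ t, x ∈ A i := by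
  induction t using Finset.induction_on with
  | empty =>
    intro S _ _ ⟨x, hx⟩ _ _
    exact ⟨x, hx, by simp⟩
  | insert m s hm ih =>
    intro S hS_comp hS_conv hS_ne hcover hpart
    by_contra hcon
    push Not at hcon
    have hinter_closed : ∀ r : Finset ι, IsClosed (⋂ i ∈ r, A i) := fun r =>
      isClosed_biInter fun i _ => hA_closed i
    have hinter_convex : ∀ r : Finset ι, Convex ℝ (⋂ i ∈ r, A i) := fun r =>
      convex_iInter₂ fun i _ => hA_convex i
    obtain ⟨q, hqS, hq⟩ := hpart m (Finset.mem_insert_self m s)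
    rw [Finset.erase_insert hm] at hq
    have hdisj : Disjoint (S ∩ A m) (S ∩ ⋂ i ∈ s, A i) := by
      rw [Set.disjoint_left]
      rintro x ⟨hxS, hxm⟩ ⟨_, hxs⟩
      obtain ⟨i, hi, hxi⟩ := hcon x hxS
      rcases Finset.mem_insert.1 hi with rfl | hi
      · exact hxi hxm
      · exact hxi (Set.mem_iInter₂.1 hxs i hi)
    -- The slice `f = u` misses `A m`, so the sets indexed by `s` cover it. Induction on this slice
    -- yields a common point of those sets, although `f > v > u` on their intersection with `S`.
    obtain ⟨f, u, v, hfu, huv, hfv⟩ := geometric_hahn_banach_compact_closed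
      (hS_conv.inter (hA_convex m)) (hS_comp.inter_right (hA_closed m))
      (hS_conv.inter (hinter_convex s)) (hS_comp.isClosed.inter (hinter_closed s)) hdisj
    have hqv : u ≤ f q := (huv.trans (hfv q ⟨hqS, Set.mem_iInter₂.2 hq⟩)).le
    have hcross : ∀ j ∈ s, ∃ c ∈ S, (∀ i ∈ s.erase j, c ∈ A i) ∧ f c = u := by
      intro j hj
      obtain ⟨p, hpS, hp⟩ := hpart j (Finset.mem_insert_of_mem hj)
      have hjm : m ≠ j := fun h => hm (h ▸ hj)
      have hpm : p ∈ A m := hp m (Finset.mem_erase.2 ⟨hjm, Finset.mem_insert_self m s⟩)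
      have hps : ∀ i ∈ s.erase j, p ∈ A i := fun i hi =>
        hp i (Finset.erase_subset_erase j (Finset.subset_insert m s) hi)
      obtain ⟨c, ⟨hcS, hc⟩, hcu⟩ := exists_mem_eq_of_convex
        (hS_conv.inter (hinter_convex (s.erase j))) f
        ⟨hpS, Set.mem_iInter₂.2 hps⟩
        ⟨hqS, Set.mem_iInter₂.2 fun i hi => hq i (Finset.mem_of_mem_erase hi)⟩
        (hfu p ⟨hpS, hpm⟩).le hqv
      exact ⟨c, hcS, Set.mem_iInter₂.1 hc, hcu⟩
    rcases s.eq_empty_or_nonempty with rfl | ⟨j, hj⟩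
    · obtain ⟨x, hx⟩ := hS_ne
      obtain ⟨i, hi, hxi⟩ := hcover x hx
      obtain ⟨k, hk, hxk⟩ := hcon x hx
      simp only [insert_empty_eq, Finset.mem_singleton] at hi hk
      exact hxk (hk ▸ hi ▸ hxi)
    · obtain ⟨c, hcS, -, hcu⟩ := hcross j hj
      obtain ⟨x, ⟨hxS, hxu⟩, hx⟩ := ih (S ∩ {x | f x = u})
        (hS_comp.inter_right (isClosed_eq f.continuous continuous_const))
        (hS_conv.inter (convex_hyperplane f.toLinearMap.isLinear u)) ⟨c, hcS, hcu⟩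
        (fun x hx => by
          obtain ⟨i, hi, hxi⟩ := hcover x hx.1
          rcases Finset.mem_insert.1 hi with rfl | hi
          · exact absurd hx.2 (hfu x ⟨hx.1, hxi⟩).ne
          · exact ⟨i, hi, hxi⟩)
        (fun j hj => by
          obtain ⟨c, hcS, hc, hcu⟩ := hcross j hj
          exact ⟨c, ⟨hcS, hcu⟩, hc⟩)
      have := hfv x ⟨hxS, Set.mem_iInter₂.2 hx⟩
      have hxu' : f x = u := hxu
      linarith

/-- The Knaster–Kuratowski–Mazurkiewicz theorem for closed convex sets. -/
theorem exists_mem_convexHull_forall_mem [DecidableEq ι] (y : ι → E) (A : ι → Set E)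
    (hA_closed : ∀ i, IsClosed (A i)) (hA_convex : ∀ i, Convex ℝ (A i))
    (hcover : ∀ t : Finset ι, ∀ x ∈ convexHull ℝ (y '' t), ∃ i ∈ t, x ∈ A i)
    (t : Finset ι) (ht : t.Nonempty) : ∃ x ∈ convexHull ℝ (y '' t), ∀ i ∈ t, x ∈ A i := by
  induction t using Finset.strongInduction with
  | H t ih =>
    have hne : (convexHull ℝ (y '' t)).Nonempty := (ht.to_set.image y).convexHull
    -- Klee's theorem applies on the hull: its partial intersections come from the induction
    -- hypothesis on smaller hulls.
    refine exists_mem_forall_mem_of_convex_cover t A hA_closed hA_convex _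
      ((t.finite_toSet.image y).isCompact_convexHull ℝ) (convex_convexHull ℝ _) hne (hcover t) ?_
    intro j hj
    rcases (t.erase j).eq_empty_or_nonempty with h | h
    · obtain ⟨x, hx⟩ := hne
      exact ⟨x, hx, by simp [h]⟩
    · obtain ⟨x, hx, hxA⟩ := ih _ (Finset.erase_ssubset hj) h
      exact ⟨x, convexHull_mono (Set.image_mono (Finset.coe_subset.2 (Finset.erase_subset j t))) hx,
        hxA⟩

end Intersection

theorem exists_mem_frontier_of_isPreconnected {X : Type*} [TopologicalSpace X] {s u : Set X}
    (hs : IsPreconnected s) (hu : IsOpen u) (hsu : (s ∩ u).Nonempty) (hsu' : (s ∩ uᶜ).Nonempty) :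
    (s ∩ frontier u).Nonempty := by
  by_contra h
  have hmem : ∀ x ∈ s, x ∈ closure u → x ∈ u := fun x hx hxu => by
    by_contra hn
    exact h ⟨x, hx, by rw [hu.frontier_eq]; exact ⟨hxu, hn⟩⟩
  obtain ⟨y, hy, hyu⟩ := hsu'
  obtain ⟨z, -, hzu, hzc⟩ := hs u (closure u)ᶜ hu isClosed_closure.isOpen_compl
    (fun x hx => or_iff_not_imp_right.2 fun hc => hmem x hx (not_not.1 hc)) hsu
    ⟨y, hy, fun hc => hyu (hmem y hy hc)⟩
  exact hzc (subset_closure hzu)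

/-! ### Variational inequalities on a closed convex set -/

section VI

variable {E : Type*} [NormedAddCommGroup E] [InnerProductSpace ℝ E] {G : E → E} {K : Set E}

theorem mem_solutionSet_iff {x : E} :
    x ∈ solutionSet K G ↔ x ∈ K ∧ ∀ y ∈ K, 0 ≤ ⟪G x, y - x⟫_ℝ := by
  simp [solutionSet, normalCone, inner_neg_left]

theorem PseudomonotoneOn.mono {K' : Set E} (hG : PseudomonotoneOn G K) (h : K' ⊆ K) :
    PseudomonotoneOn G K' :=
  fun x hx y hy => hG x (h hx) y (h hy)

/-- The half-space of points `x` with `⟨G y, y - x⟩ ≥ 0`. -/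
def mintyHalfSpace (G : E → E) (y : E) : Set E :=
  {x | ⟪G y, x⟫_ℝ ≤ ⟪G y, y⟫_ℝ}

/-- Otherwise pseudomonotonicity, read contrapositively, puts every `y ∈ t` in the open half-space
`⟪G x, y - x⟫ < 0`; by convexity `x` would lie there too. -/
theorem exists_mem_mintyHalfSpace (hK : Convex ℝ K) (hG : PseudomonotoneOn G K) (t : Finset K)
    {x : E} (hx : x ∈ convexHull ℝ ((↑) '' (t : Set K))) : ∃ y ∈ t, x ∈ mintyHalfSpace G y := by
  by_contra! hcon
  have hxK : x ∈ K := convexHull_min (by rintro _ ⟨y, _, rfl⟩; exact y.2) hK hx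
  have hsub : ((↑) '' (t : Set K) : Set E) ⊆ {y | ⟪G x, y⟫_ℝ < ⟪G x, x⟫_ℝ} := by
    rintro _ ⟨y, hy, rfl⟩
    by_contra! h
    replace h : ⟪G x, x⟫_ℝ ≤ ⟪G x, y⟫_ℝ := not_lt.1 h
    have h1 : 0 ≤ ⟪(y : E) - x, G x⟫_ℝ := by
      rw [real_inner_comm, inner_sub_right]; linarith
    have h2 := hG x hxK y y.2 h1
    rw [real_inner_comm, inner_sub_right] at h2
    exact hcon y hy (sub_nonneg.1 h2)
  have hxx : ⟪G x, x⟫_ℝ < ⟪G x, x⟫_ℝ :=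
    convexHull_min hsub (convex_halfSpace_lt (innerSL ℝ (G x)).toLinearMap.isLinear _) hx
  exact lt_irrefl _ hxx

/-- On a compact convex set a pseudomonotone mapping has a Minty solution. -/
theorem exists_minty_solution (hK : Convex ℝ K) (hK_comp : IsCompact K) (hK_ne : K.Nonempty)
    (hG : PseudomonotoneOn G K) : ∃ x ∈ K, ∀ y ∈ K, 0 ≤ ⟪G y, y - x⟫_ℝ := by
  classical
  have hclosed : ∀ y : K, IsClosed (mintyHalfSpace G (y : E)) := fun y =>
    isClosed_le (by fun_prop) continuous_const
  have hconvex : ∀ y : K, Convex ℝ (mintyHalfSpace G (y : E)) := fun y =>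
    convex_halfSpace_le (innerSL ℝ (G y)).toLinearMap.isLinear _
  obtain ⟨x, hxK, hx⟩ := hK_comp.inter_iInter_nonempty
    (fun y : K => mintyHalfSpace G (y : E)) hclosed (fun t => by
      rcases t.eq_empty_or_nonempty with rfl | ht
      · simpa using hK_ne
      · obtain ⟨x, hx, hxt⟩ := exists_mem_convexHull_forall_mem (fun y : K => (y : E))
          (fun y : K => mintyHalfSpace G (y : E)) hclosed hconvex
          (fun t x hx => exists_mem_mintyHalfSpace hK hG t hx) t ht
        exact ⟨x, convexHull_min (by rintro _ ⟨y, _, rfl⟩; exact y.2) hK hx,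
          Set.mem_iInter₂.2 hxt⟩)
  refine ⟨x, hxK, fun y hy => ?_⟩
  rw [inner_sub_right]
  exact sub_nonneg.2 (Set.mem_iInter.1 hx ⟨y, hy⟩)

/-- Minty's lemma: for a continuous mapping, Minty solutions solve the variational inequality. -/
theorem mem_solutionSet_of_minty (hK : Convex ℝ K) (hG : Continuous G) {x : E} (hx : x ∈ K)
    (h : ∀ y ∈ K, 0 ≤ ⟪G y, y - x⟫_ℝ) : x ∈ solutionSet K G := by
  refine mem_solutionSet_iff.2 ⟨hx, fun y hy => ?_⟩
  have hlim : Filter.Tendsto (fun s : ℝ => ⟪G (x + s • (y - x)), y - x⟫_ℝ)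
      (nhdsWithin 0 (Set.Ioi 0)) (nhds ⟪G x, y - x⟫_ℝ) := by
    have hc : Continuous fun s : ℝ => ⟪G (x + s • (y - x)), y - x⟫_ℝ := by fun_prop
    simpa using (hc.tendsto 0).mono_left nhdsWithin_le_nhds
  refine ge_of_tendsto hlim ?_
  filter_upwards [Ioc_mem_nhdsGT (zero_lt_one (α := ℝ))] with s hs
  have h1 := h _ (hK.add_smul_sub_mem hx hy ⟨hs.1.le, hs.2⟩)
  rw [add_sub_cancel_left, inner_smul_right] at h1
  exact nonneg_of_mul_nonneg_right h1 hs.1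

theorem solutionSet_nonempty_of_isCompact (hK : Convex ℝ K) (hK_comp : IsCompact K)
    (hK_ne : K.Nonempty) (hG_cont : Continuous G) (hG : PseudomonotoneOn G K) :
    (solutionSet K G).Nonempty := by
  obtain ⟨x, hx, h⟩ := exists_minty_solution hK hK_comp hK_ne hG
  exact ⟨x, mem_solutionSet_of_minty hK hG_cont hx h⟩

/-- A solution on a truncation of `K` solves the problem on `K`, as soon as its linearised gap
vanishes at some point interior to the truncating ball. -/
theorem mem_solutionSet_of_truncation (hK : Convex ℝ K) {R : ℝ} {x z : E}
    (hx : x ∈ solutionSet (K ∩ Metric.closedBall 0 R) G) (hz : z ∈ K) (hzR : ‖z‖ < R)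
    (hgap : ⟪G x, z - x⟫_ℝ ≤ 0) : x ∈ solutionSet K G := by
  obtain ⟨hxK, hsol⟩ := mem_solutionSet_iff.1 hx
  refine mem_solutionSet_iff.2 ⟨hxK.1, fun y hy => ?_⟩
  have hlim : Filter.Tendsto (fun s : ℝ => ‖z + s • (y - z)‖) (nhdsWithin 0 (Set.Ioi 0))
      (nhds ‖z‖) := by
    have hc : Continuous fun s : ℝ => ‖z + s • (y - z)‖ := by fun_prop
    simpa using (hc.tendsto 0).mono_left nhdsWithin_le_nhds
  obtain ⟨s, hsR, hs⟩ := ((hlim.eventually_lt_const hzR).and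
    (Ioc_mem_nhdsGT (zero_lt_one (α := ℝ)))).exists
  -- With `hgap`, `z` also minimises `⟪G x, ·⟫` on the truncation. Since `‖z‖ < R`, a short step
  -- from `z` towards any `y ∈ K` stays inside the ball.
  have hz0 : 0 ≤ ⟪G x, z - x⟫_ℝ := hsol z ⟨hz, by simpa using hzR.le⟩
  have h1 := hsol (z + s • (y - z))
    ⟨hK.add_smul_sub_mem hz hy ⟨hs.1.le, hs.2⟩, by simpa using hsR.le⟩
  rw [add_sub_right_comm, inner_add_right, inner_smul_right] at h1
  have h2 : 0 ≤ ⟪G x, y - z⟫_ℝ := nonneg_of_mul_nonneg_right (by linarith) hs.1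
  have h3 : ⟪G x, y - x⟫_ℝ = ⟪G x, y - z⟫_ℝ + ⟪G x, z - x⟫_ℝ := by
    rw [← inner_add_right, sub_add_sub_cancel]
  linarith

theorem solutionSet_nonempty_of_frontier [FiniteDimensional ℝ E] (hK : Convex ℝ K)
    (hK_closed : IsClosed K) (hG_cont : Continuous G) (hG : PseudomonotoneOn G K) {Ω : Set E}
    (hΩ_bdd : Bornology.IsBounded Ω) (hΩ_open : IsOpen Ω) {xhat : E} (hxhat : xhat ∈ K ∩ Ω)
    (hΩ : ∀ x ∈ K ∩ frontier Ω, 0 ≤ ⟪G x, x - xhat⟫_ℝ) : (solutionSet K G).Nonempty := by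
  obtain ⟨R, hR⟩ := hΩ_bdd.closure.subset_ball 0
  have hnorm : ∀ z ∈ closure Ω, ‖z‖ < R := fun z hz => by simpa using hR hz
  have := FiniteDimensional.proper_real E
  obtain ⟨x, hx⟩ := solutionSet_nonempty_of_isCompact (K := K ∩ Metric.closedBall 0 R)
    (hK.inter (convex_closedBall 0 R)) ((isCompact_closedBall 0 R).inter_left hK_closed)
    ⟨xhat, hxhat.1, by simpa using (hnorm xhat (subset_closure hxhat.2)).le⟩ hG_cont
    (hG.mono Set.inter_subset_left)
  have hxK : x ∈ K := (mem_solutionSet_iff.1 hx).1.1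
  refine ⟨x, ?_⟩
  by_cases hxΩ : x ∈ Ω
  · exact mem_solutionSet_of_truncation hK hx hxK (hnorm x (subset_closure hxΩ)) (by simp)
  -- The solution lies outside `Ω`, so the segment from `xhat` crosses the frontier at some `z`.
  -- There the hypothesis gives `⟪G z, x - z⟫ ≥ 0`, and pseudomonotonicity moves it to `⟪G x, x - z⟫
  -- ≥ 0`, the gap condition for `z`.
  obtain ⟨z, hz, hzΩ⟩ := exists_mem_frontier_of_isPreconnected
    (convex_segment (𝕜 := ℝ) xhat x).isPreconnected hΩ_open
    ⟨xhat, left_mem_segment ℝ xhat x, hxhat.2⟩ ⟨x, right_mem_segment ℝ xhat x, hxΩ⟩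
  have hzK : z ∈ K := hK.segment_subset hxhat.1 hxK hz
  refine mem_solutionSet_of_truncation hK hx hzK (hnorm z (frontier_subset_closure hzΩ)) ?_
  have hmono := hΩ z ⟨hzK, hzΩ⟩
  rw [segment_eq_image'] at hz
  obtain ⟨s, hs, hsz⟩ := hz
  have hz_def : z = xhat + s • (x - xhat) := hsz.symm
  have hs0 : 0 < s := by
    rcases hs.1.lt_or_eq with h | h
    · exact h
    · have hzx : z = xhat := by rw [hz_def, ← h]; simp
      rw [hΩ_open.frontier_eq, hzx] at hzΩ
      exact absurd hxhat.2 hzΩ.2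
  have hzs : z - xhat = s • (x - xhat) := by rw [hz_def, add_sub_cancel_left]
  rw [hzs, inner_smul_right] at hmono
  have h1 : 0 ≤ ⟪G z, x - xhat⟫_ℝ := nonneg_of_mul_nonneg_right hmono hs0
  have h2 : x - z = (1 - s) • (x - xhat) := by rw [hz_def]; module
  have h3 : 0 ≤ ⟪x - z, G z⟫_ℝ := by
    rw [real_inner_comm, h2, inner_smul_right]
    exact mul_nonneg (sub_nonneg.2 hs.2) h1
  have h4 := hG z hzK x hxK h3
  rw [real_inner_comm] at h4
  rw [← neg_sub, inner_neg_right]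
  linarith

/-- Pseudomonotonicity turns a solution into a Minty solution. -/
theorem strictSublevel_eq_empty (hG : PseudomonotoneOn G K) {x : E} (hx : x ∈ solutionSet K G) :
    strictSublevel K G x = ∅ := by
  obtain ⟨hxK, hsol⟩ := mem_solutionSet_iff.1 hx
  refine Set.eq_empty_of_forall_notMem fun y ⟨hy, hlt⟩ => hlt.not_ge ?_
  rw [real_inner_comm]
  exact hG x hxK y hy (by rw [real_inner_comm]; exact hsol y hy)

theorem exists_bounded_open_of_strictSublevel {xhat : E} (hxhat : xhat ∈ K)
    (h : Bornology.IsBounded (strictSublevel K G xhat)) :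
    ∃ Ω : Set E, Bornology.IsBounded Ω ∧ IsOpen Ω ∧
      ∃ xhat ∈ K ∩ Ω, ∀ x ∈ K ∩ frontier Ω, 0 ≤ ⟪G x, x - xhat⟫_ℝ := by
  obtain ⟨R, hR⟩ := (h.insert xhat).subset_ball 0
  refine ⟨Metric.ball 0 R, Metric.isBounded_ball, Metric.isOpen_ball, xhat,
    ⟨hxhat, hR (Set.mem_insert _ _)⟩, fun x hx => ?_⟩
  by_contra! hlt
  have hx2 := hx.2
  -- An open ball is disjoint from its frontier, yet it contains the whole strict sublevel set.
  rw [Metric.isOpen_ball.frontier_eq] at hx2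
  exact hx2.2 (hR (Set.mem_insert_of_mem _ ⟨hx.1, hlt⟩))

theorem isClosed_solutionSet (hK_closed : IsClosed K) (hG_cont : Continuous G) :
    IsClosed (solutionSet K G) := by
  have h : solutionSet K G = K ∩ ⋂ y ∈ K, {x | 0 ≤ ⟪G x, y - x⟫_ℝ} := by
    ext x
    simp [mem_solutionSet_iff]
  rw [h]
  exact hK_closed.inter (isClosed_biInter fun y _ => isClosed_le continuous_const (by fun_prop))

theorem solutionSet_subset_weakSublevel {xhat : E} (hxhat : xhat ∈ K) :
    solutionSet K G ⊆ weakSublevel K G xhat := by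
  intro x hx
  obtain ⟨hxK, hsol⟩ := mem_solutionSet_iff.1 hx
  refine ⟨hxK, ?_⟩
  rw [← neg_sub, inner_neg_right]
  linarith [hsol xhat hxhat]

end VI

/-! ### Convexity and closedness of the feasible set -/

section Feasible

variable {N : ℕ} {n : Fin N → ℕ} {Ξ : Fin N → Type*} [∀ k, Fintype (Ξ k)] {P : ScenarioProb Ξ}

instance : FiniteDimensional ℝ (Lspace n P) :=
  inferInstanceAs (FiniteDimensional ℝ (Scenario Ξ → StageVec n))

/-- Evaluation of a mapping at a scenario. -/
def evalAt (P : ScenarioProb Ξ) (ξ : Scenario Ξ) : Lspace n P →ₗ[ℝ] StageVec n where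
  toFun x := x ξ
  map_add' _ _ := rfl
  map_smul' _ _ := rfl

theorem constraintSet_eq (C : Scenario Ξ → Set (StageVec n)) :
    constraintSet P C = ⋂ ξ, evalAt P ξ ⁻¹' C ξ := by
  ext x
  simp only [Set.mem_iInter]
  rfl

theorem convex_feasibleSet {C : Scenario Ξ → Set (StageVec n)} (hC : ∀ ξ, Convex ℝ (C ξ)) :
    Convex ℝ (feasibleSet P C) := by
  rw [feasibleSet, constraintSet_eq]
  exact (convex_iInter fun ξ => (hC ξ).linear_preimage (evalAt P ξ)).inter
    (nonanticipative n P).convex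

theorem isClosed_feasibleSet {C : Scenario Ξ → Set (StageVec n)} (hC : ∀ ξ, IsClosed (C ξ)) :
    IsClosed (feasibleSet P C) := by
  rw [feasibleSet, constraintSet_eq]
  -- Finite dimension makes evaluation continuous for the weighted norm and the nonanticipativity
  -- subspace closed.
  exact (isClosed_iInter fun ξ =>
    (hC ξ).preimage (evalAt P ξ).continuous_of_finiteDimensional).inter
    (nonanticipative n P).closed_of_finiteDimensional

end Feasible

end StochasticVI

open StochasticVI in
theorem mainTheorem1 {N : ℕ} (n : Fin N → ℕ) (Ξ : Fin N → Type*) [∀ k, Fintype (Ξ k)]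
    (P : ScenarioProb Ξ)
    (C : Scenario Ξ → Set (StageVec n))
    (hC_nonempty : ∀ ξ, (C ξ).Nonempty)
    (hC_closed : ∀ ξ, IsClosed (C ξ))
    (hC_convex : ∀ ξ, Convex ℝ (C ξ))
    (F : StageVec n → Scenario Ξ → StageVec n)
    (hF_cont : Continuous (superposition P F))
    (hF_pseudo : PseudomonotoneOn (superposition P F) (feasibleSet P C)) :
    List.TFAE
      [∃ xhat ∈ feasibleSet P C,
          Bornology.IsBounded (strictSublevel (feasibleSet P C) (superposition P F) xhat),
        ∃ Ω : Set (Lspace n P), Bornology.IsBounded Ω ∧ IsOpen Ω ∧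
          ∃ xhat ∈ feasibleSet P C ∩ Ω, ∀ x ∈ feasibleSet P C ∩ frontier Ω,
            0 ≤ inner ℝ (superposition P F x) (x - xhat),
        (solutionSet (feasibleSet P C) (superposition P F)).Nonempty] ∧
    ((∃ xhat ∈ feasibleSet P C,
        Bornology.IsBounded (weakSublevel (feasibleSet P C) (superposition P F) xhat)) →
      (solutionSet (feasibleSet P C) (superposition P F)).Nonempty ∧
      IsCompact (solutionSet (feasibleSet P C) (superposition P F))) := by
  have hK := convex_feasibleSet (P := P) hC_convex
  have hK_closed := isClosed_feasibleSet (P := P) hC_closed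
  have hab : (∃ xhat ∈ feasibleSet P C,
      Bornology.IsBounded (strictSublevel (feasibleSet P C) (superposition P F) xhat)) →
      (solutionSet (feasibleSet P C) (superposition P F)).Nonempty := by
    rintro ⟨xhat, hxhat, h⟩
    obtain ⟨Ω, hΩ_bdd, hΩ_open, y, hy, hΩ⟩ := exists_bounded_open_of_strictSublevel hxhat h
    exact solutionSet_nonempty_of_frontier hK hK_closed hF_cont hF_pseudo hΩ_bdd hΩ_open hy hΩ
  refine ⟨?_, ?_⟩
  · tfae_have 1 → 2 := fun ⟨_, hxhat, h⟩ => exists_bounded_open_of_strictSublevel hxhat h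
    tfae_have 2 → 3 := fun ⟨_, hΩ_bdd, hΩ_open, _, hy, hΩ⟩ =>
      solutionSet_nonempty_of_frontier hK hK_closed hF_cont hF_pseudo hΩ_bdd hΩ_open hy hΩ
    tfae_have 3 → 1 := fun ⟨x, hx⟩ => ⟨x, (mem_solutionSet_iff.1 hx).1, by
      rw [strictSublevel_eq_empty hF_pseudo hx]; exact Bornology.isBounded_empty⟩
    tfae_finish
  · rintro ⟨xhat, hxhat, h⟩
    have := FiniteDimensional.proper_real (Lspace n P)
    exact ⟨hab ⟨xhat, hxhat, h.subset fun x hx => ⟨hx.1, hx.2.le⟩⟩,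
      Metric.isCompact_of_isClosed_isBounded (isClosed_solutionSet hK_closed hF_cont)
        (h.subset (solutionSet_subset_weakSublevel hxhat))⟩
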